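/- For a countable set $S$ give $\{0,1\}^S$ the product topology, the product $\sigma$-algebra and the coordinatewise order. For $p\in[0,1]$ let $\pi_p$ be the product measure on $\{0,1\}^S$ under which the coordinates are independent and equal $1$ with probability $p$. For probability measures $\mu,\nu$ on $\{0,1\}^S$ write $\mu\preceq\nu$ if $\int f\,d\mu\le\int f\,d\nu$ for every continuous function $f:\{0,1\}^S\to\mathbb{R}$ that is increasing in the coordinatewise order. Let $p_{\max,\mu}=\sup\{p\in[0,1]:\pi_p\preceq\mu\}$. For $\epsilon\in(0,1)$ let $\mu^{(-,\epsilon)}$ be the law of the configuration obtained by choosing an element of $\{0,1\}^S$ according to $\mu$ and then changing each $1$ to a $0$ independently with probability $\epsilon$. Call $\mu$ nonrigid if $\pi_{p_{\max,\mu}}\preceq\mu$ and there is $\epsilon\in(0,1)$ with $\pi_{p_{\max,\mu}}\preceq\mu^{(-,\epsilon)}$. **Theorem.** (1) For every countably infinite set $S$ there is a probability measure $\mu$ on $\{0,1\}^S$ that dominates a nontrivial product measure (that is, $\pi_p\preceq\mu$ for some $p\in(0,1)$), with $p_{\max,\mu}=\tfrac12$, and that is nevertheless nonrigid; thus $\pi_{1/2}\preceq\mu^{(-,\epsilon)}$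 for some $\epsilon\in(0,1)$. (2) Moreover, for $S=\mathbb{Z}$ there is a probability measure $\mu$ on $\{0,1\}^{\mathbb{Z}}$ with all the properties in (1) that is in addition invariant under all translations of $\mathbb{Z}$. -/

import Mathlib

open MeasureTheory

noncomputable section

/-- The space `{0,1}^S`, with `true` for `1` and `false` for `0`. Its order, topology and
σ-algebra are the coordinatewise order, the product topology and the product σ-algebra. -/
abbrev Config (S : Type*) : Type _ := S → Bool

/-- The uniform product measure `π_p` on `{0,1}^S`. -/
def prodMeasure (S : Type*) (p : unitInterval) : Measure (Config S) :=
  Measure.infinitePi fun _ : S => ProbabilityTheory.bernoulliMeasure true false p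

/-- Stochastic domination `μ ⪯ ν`: `∫ f dμ ≤ ∫ f dν` for all continuous increasing `f`. -/
def StochDom {S : Type*} (μ ν : Measure (Config S)) : Prop :=
  ∀ f : Config S → ℝ, Continuous f → Monotone f → ∫ σ, f σ ∂μ ≤ ∫ σ, f σ ∂ν

/-- `μ^{(-,ε)}`: choose `σ` according to `μ` and, independently of `σ`, a family `ω` of independent
marks, each present with probability `ε`; change `σ s` to `0` wherever `s` is marked. -/
def thinning {S : Type*} (μ : Measure (Config S)) (ε : unitInterval) : Measure (Config S) :=
  (μ.prod (prodMeasure S ε)).map fun x s => x.1 s && !(x.2 s)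

/-- The pair `(μ, ν)` is downwards movable. -/
def DownwardsMovable {S : Type*} (μ ν : Measure (Config S)) : Prop :=
  StochDom μ ν ∧ ∃ ε : unitInterval, 0 < ε ∧ ε < 1 ∧ StochDom μ (thinning ν ε)

/-- `p_{max,μ}`, the supremum in `[0,1]` of all `p` with `π_p ⪯ μ`. -/
def pMax {S : Type*} (μ : Measure (Config S)) : unitInterval :=
  sSup {p : unitInterval | StochDom (prodMeasure S p) μ}

/-- `μ` is nonrigid: the pair `(π_{p_max}, μ)` is downwards movable. -/
def Nonrigid {S : Type*} (μ : Measure (Config S)) : Prop :=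
  DownwardsMovable (prodMeasure S (pMax μ)) μ

/-- Invariance of a measure on `{0,1}^ℤ` under all translations. -/
def TranslationInvariant (μ : Measure (Config ℤ)) : Prop :=
  ∀ n : ℤ, μ.map (fun σ s => σ (s + n)) = μ

end

noncomputable section

/-! Identify `S` with `ℤ`, cut it into blocks of length `N`, and set each whole block to `0`
independently with probability `δ = 2^{-(N+1)}`, leaving all other coordinates `1`. Thin with
retention probability `q = √(1/2)`. On a block the result is `0` with probability `δ` and otherwise
has law `π_q`, so domination of `π_{1/2}` there amounts to `π_{1/2}(A) ≤ (1-δ) π_q(A)` for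
increasing `A` avoiding the zero block. This follows from two bounds: `π_{1/2}(A) ≤ π_q(A)²`, since
`q² = 1/2`, and `π_{1/2}(A) ≤ 1 - 2^{-N} = 1 - 2δ` (`prodMeasure_half_le`). Blocks are independent
under both measures, so `LDom.of_blocks` extends the comparison to `S`.

The retention `q` does not depend on `N`, so domination survives averaging over shifts, which gives
translation invariance on `ℤ`, and mixing over `N = 2^k` with weights `2^{-(k+1)}`. The mixture
makes a block of length `N` vanish with probability at least `2^{-N}` up to a polynomial factor, for
arbitrarily large `N`. If it dominates `π_p`, then `(1-p)^N` is at least this large, which forces `p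
≤ 1/2`. Hence `p_max = 1/2` is attained even after thinning. -/

instance prodMeasure.instIsProbabilityMeasure (S : Type*) (p : unitInterval) :
    IsProbabilityMeasure (prodMeasure S p) := by
  unfold prodMeasure; infer_instance

/-! ### Cylinder events and product measures -/

/-- The event that all coordinates in `T` equal `1`. -/
def allOn {S : Type*} (T : Finset S) : Set (Config S) := {σ | ∀ s ∈ T, σ s = true}

/-- The event that all coordinates in `T` equal `0`. -/
def allOff {S : Type*} (T : Finset S) : Set (Config S) := {σ | ∀ s ∈ T, σ s = false}

variable {S J : Type*}

lemma measurableSet_coord (s : S) (a : Bool) : MeasurableSet {σ : Config S | σ s = a} :=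
  measurableSet_eq_fun (measurable_pi_apply s) measurable_const

lemma measurableSet_allOn (T : Finset S) : MeasurableSet (allOn T) := by
  have : allOn T = ⋂ s ∈ T, {σ : Config S | σ s = true} := by ext; simp [allOn]
  rw [this]
  exact T.measurableSet_biInter fun s _ => measurableSet_coord s true

lemma measurableSet_allOff (T : Finset S) : MeasurableSet (allOff T) := by
  have : allOff T = ⋂ s ∈ T, {σ : Config S | σ s = false} := by ext; simp [allOff]
  rw [this]
  exact T.measurableSet_biInter fun s _ => measurableSet_coord s false

lemma prodMeasure_allOn (p : unitInterval) (T : Finset S) :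
    prodMeasure S p (allOn T) = (unitInterval.toNNReal p : ENNReal) ^ T.card := by
  have : allOn T = Set.pi (T : Set S) (fun _ => {true}) := by ext; simp [allOn, Set.pi]
  rw [this, prodMeasure, Measure.infinitePi_pi _ (fun _ _ => measurableSet_singleton _)]
  simp

lemma prodMeasure_allOff (p : unitInterval) (T : Finset S) :
    prodMeasure S p (allOff T) =
      (unitInterval.toNNReal (unitInterval.symm p) : ENNReal) ^ T.card := by
  have : allOff T = Set.pi (T : Set S) (fun _ => {false}) := by ext; simp [allOff, Set.pi]
  rw [this, prodMeasure, Measure.infinitePi_pi _ (fun _ _ => measurableSet_singleton _)]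
  simp

/-- A probability measure on `{0,1}^S` is determined by the probabilities of `allOn T`. -/
lemma ext_of_allOn {μ ν : Measure (Config S)} [IsProbabilityMeasure μ] [IsProbabilityMeasure ν]
    (h : ∀ T : Finset S, μ (allOn T) = ν (allOn T)) : μ = ν := by
  classical
  refine ext_of_generate_finite (Set.range (allOn (S := S))) ?_ ?_ ?_ (by simp)
  · apply le_antisymm
    · refine iSup_le fun s => ?_
      rintro _ ⟨t, -, rfl⟩
      have h1 : MeasurableSet[MeasurableSpace.generateFrom (Set.range (allOn (S := S)))]
          {σ : Config S | σ s = true} := by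
        refine MeasurableSpace.measurableSet_generateFrom ⟨{s}, ?_⟩
        ext; simp [allOn]
      have h2 : (fun σ : Config S => σ s) ⁻¹' t =
          (if true ∈ t then {σ : Config S | σ s = true} else ∅) ∪
          (if false ∈ t then {σ : Config S | σ s = true}ᶜ else ∅) := by
        ext σ
        by_cases a : true ∈ t <;> by_cases b : false ∈ t <;> cases hs : σ s <;> simp [a, b, hs]
      rw [h2]
      refine MeasurableSet.union ?_ ?_
      · split_ifs
        · exact h1
        · exact @MeasurableSet.empty _ (MeasurableSpace.generateFrom _)
      · split_ifs
        · exact h1.compl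
        · exact @MeasurableSet.empty _ (MeasurableSpace.generateFrom _)
    · refine MeasurableSpace.generateFrom_le ?_
      rintro _ ⟨T, rfl⟩
      exact measurableSet_allOn T
  · rintro _ ⟨T, rfl⟩ _ ⟨U, rfl⟩ -
    refine ⟨T ∪ U, ?_⟩
    ext σ
    simp only [allOn, Finset.mem_union, Set.mem_ofPred_eq, Set.mem_inter_iff]
    grind
  · rintro _ ⟨T, rfl⟩
    exact h T

/-! ### Splicing configurations and resampling coordinates -/

/-- The configuration equal to `y` on `A` and to `x` off `A`. -/
def splice (A : Set S) (x y : Config S) : Config S := by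
  classical exact A.piecewise y x

lemma splice_of_mem {A : Set S} {s : S} (h : s ∈ A) (x y : Config S) : splice A x y s = y s := by
  simp [splice, h]

lemma splice_of_notMem {A : Set S} {s : S} (h : s ∉ A) (x y : Config S) :
    splice A x y s = x s := by
  simp [splice, h]

lemma measurable_splice (A : Set S) :
    Measurable fun x : Config S × Config S => splice A x.1 x.2 := by
  refine measurable_pi_iff.2 fun s => ?_
  by_cases h : s ∈ A
  · simp only [splice_of_mem h]; fun_prop
  · simp only [splice_of_notMem h]; fun_prop

@[fun_prop]
lemma Measurable.splice {X : Type*} [MeasurableSpace X] (A : Set S) {f g : X → Config S}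
    (hf : Measurable f) (hg : Measurable g) : Measurable fun x => splice A (f x) (g x) :=
  (measurable_splice A).comp (hf.prodMk hg)

lemma monotone_splice_right (A : Set S) (x : Config S) : Monotone (splice A x) := by
  intro y z h s
  by_cases hs : s ∈ A
  · simpa only [splice_of_mem hs] using h s
  · simp only [splice_of_notMem hs, le_refl]

/-- `μ` is unchanged if the coordinates in `A` are replaced by those of an independent copy. -/
def ResampleInvariant (A : Set S) (μ : Measure (Config S)) : Prop :=
  ∀ F : Config S → ENNReal, Measurable F →
    ∫⁻ x, ∫⁻ y, F (splice A x y) ∂μ ∂μ = ∫⁻ x, F x ∂μ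

/-- The preimage of `allOn T` under splicing is a rectangle whose sides involve the parts of `T` off
and on `A`, so its probability is again `p ^ |T|`. -/
lemma resampleInvariant_prodMeasure (A : Set S) (p : unitInterval) :
    ResampleInvariant A (prodMeasure S p) := by
  classical
  intro F hF
  have key : ((prodMeasure S p).prod (prodMeasure S p)).map (fun x => splice A x.1 x.2) =
      prodMeasure S p := by
    have : IsProbabilityMeasure (((prodMeasure S p).prod (prodMeasure S p)).map
      (fun x => splice A x.1 x.2)) := Measure.isProbabilityMeasure_map (by fun_prop)
    refine ext_of_allOn fun T => ?_
    rw [Measure.map_apply (by fun_prop) (measurableSet_allOn T)]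
    have : (fun x : Config S × Config S => splice A x.1 x.2) ⁻¹' allOn T =
        allOn (T.filter (· ∉ A)) ×ˢ allOn (T.filter (· ∈ A)) := by
      ext ⟨x, y⟩
      simp only [allOn, Set.mem_preimage, Set.mem_ofPred_eq, Set.mem_prod, Finset.mem_filter]
      constructor
      · exact fun h => ⟨fun s hs => by rw [← h s hs.1, splice_of_notMem hs.2],
          fun s hs => by rw [← h s hs.1, splice_of_mem hs.2]⟩
      · rintro ⟨h1, h2⟩ s hs
        by_cases hA : s ∈ A
        · rw [splice_of_mem hA, h2 s ⟨hs, hA⟩]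
        · rw [splice_of_notMem hA, h1 s ⟨hs, hA⟩]
    rw [this, Measure.prod_prod, prodMeasure_allOn, prodMeasure_allOn, prodMeasure_allOn,
      ← pow_add, add_comm, Finset.card_filter_add_card_filter_not]
  conv_rhs => rw [← key]
  rw [lintegral_map hF (by fun_prop), lintegral_prod _ (by fun_prop)]

@[fun_prop]
lemma Measurable.bool_not {X : Type*} [MeasurableSpace X] {f : X → Bool} (hf : Measurable f) :
    Measurable fun x => !f x :=
  (measurable_of_finite Bool.not).comp hf

@[fun_prop]
lemma Measurable.bool_and {X : Type*} [MeasurableSpace X] {f g : X → Bool} (hf : Measurable f)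
    (hg : Measurable g) : Measurable fun x => f x && g x :=
  (measurable_of_finite (fun a : Bool × Bool => a.1 && a.2)).comp (hf.prodMk hg)

/-! ### Images of product measures under flips, relabellings and minima -/

/-- Flipping all coordinates turns `π_p` into `π_{1-p}`. -/
lemma prodMeasure_map_not (p : unitInterval) :
    (prodMeasure S p).map (fun σ s => !σ s) = prodMeasure S (unitInterval.symm p) := by
  have hm : Measurable fun (σ : Config S) s => !σ s :=
    by fun_prop
  have : IsProbabilityMeasure ((prodMeasure S p).map (fun σ s => !σ s)) :=
    Measure.isProbabilityMeasure_map hm.aemeasurable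
  refine ext_of_allOn fun T => ?_
  rw [Measure.map_apply hm (measurableSet_allOn T), prodMeasure_allOn, ← prodMeasure_allOff]
  congr 1
  ext; simp [allOn, allOff]

/-- Relabelling the coordinates leaves `π_p` unchanged. -/
lemma prodMeasure_map_comp {e : S → J} (he : Function.Injective e) (p : unitInterval) :
    (prodMeasure J p).map (fun σ s => σ (e s)) = prodMeasure S p := by
  have hm : Measurable fun (σ : Config J) s => σ (e s) :=
    measurable_pi_iff.2 fun s => measurable_pi_apply _
  have : IsProbabilityMeasure ((prodMeasure J p).map (fun σ s => σ (e s))) :=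
    Measure.isProbabilityMeasure_map hm.aemeasurable
  refine ext_of_allOn fun T => ?_
  rw [Measure.map_apply hm (measurableSet_allOn T), prodMeasure_allOn,
    ← Finset.card_map ⟨e, he⟩, ← prodMeasure_allOn]
  congr 1
  ext; simp [allOn]

lemma measurable_config_and : Measurable fun (x : Config S × Config S) s => x.1 s && x.2 s :=
  by fun_prop

/-- The coordinatewise minimum of independent `π_p` and `π_q` has law `π_{pq}`. -/
lemma prodMeasure_map_and (p q : unitInterval) :
    ((prodMeasure S p).prod (prodMeasure S q)).map (fun x s => x.1 s && x.2 s) =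
      prodMeasure S (p * q) := by
  have hm := measurable_config_and (S := S)
  have : IsProbabilityMeasure (((prodMeasure S p).prod (prodMeasure S q)).map
      (fun x s => x.1 s && x.2 s)) := Measure.isProbabilityMeasure_map hm.aemeasurable
  refine ext_of_allOn fun T => ?_
  have h : (fun (x : Config S × Config S) s => x.1 s && x.2 s) ⁻¹' allOn T =
      allOn T ×ˢ allOn T := by
    ext ⟨x, y⟩
    simp only [allOn, Set.mem_preimage, Set.mem_ofPred_eq, Set.mem_prod, Bool.and_eq_true]
    grind
  rw [Measure.map_apply hm (measurableSet_allOn T), h, Measure.prod_prod, prodMeasure_allOn,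
    prodMeasure_allOn, prodMeasure_allOn, ← mul_pow, ← ENNReal.coe_mul]
  congr 2

/-- For an increasing event, `π_{q²}(A) ≤ π_q(A)²`. -/
lemma prodMeasure_mul_self_le {A : Set (Config S)} (hA : MeasurableSet A) (hu : IsUpperSet A)
    (q : unitInterval) : prodMeasure S (q * q) A ≤ prodMeasure S q A ^ 2 := by
  rw [← prodMeasure_map_and, Measure.map_apply measurable_config_and hA, sq, ← Measure.prod_prod]
  refine measure_mono fun x hx => ⟨hu (fun s => ?_) hx, hu (fun s => ?_) hx⟩
  · exact Bool.and_le_left _ _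
  · exact Bool.and_le_right _ _

/-! ### Domination tested on nonnegative functions -/

/-- Two measures compare on nonnegative increasing continuous functions. -/
def LDom (μ ν : Measure (Config S)) : Prop :=
  ∀ F : Config S → NNReal, Continuous F → Monotone F → ∫⁻ x, F x ∂μ ≤ ∫⁻ x, F x ∂ν

lemma integrable_of_continuous [Countable S] {μ : Measure (Config S)} [IsFiniteMeasure μ]
    {f : Config S → ℝ} (hf : Continuous f) : Integrable f μ :=
  hf.integrable_of_hasCompactSupport (HasCompactSupport.of_compactSpace f)

/-- An increasing `f` has minimum `f ⊥`; subtracting it makes `f` nonnegative and changes both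
integrals by the same constant. -/
lemma LDom.stochDom [Countable S] {μ ν : Measure (Config S)} [IsProbabilityMeasure μ]
    [IsProbabilityMeasure ν] (h : LDom μ ν) : StochDom μ ν := by
  intro f hf hm
  have key : ∀ (m : Measure (Config S)) [IsProbabilityMeasure m], ∫ x, f x ∂m =
      (∫⁻ x, Real.toNNReal (f x - f ⊥) ∂m).toReal + f ⊥ := by
    intro m _
    have h1 := integral_eq_lintegral_of_nonneg_ae (μ := m) (f := fun x => f x - f ⊥)
      (Filter.Eventually.of_forall fun x => sub_nonneg.2 (hm bot_le))
      (by fun_prop)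
    rw [integral_sub (integrable_of_continuous hf) (integrable_const _)] at h1
    simp only [integral_const, probReal_univ, smul_eq_mul, one_mul] at h1
    simp only [ENNReal.ofReal] at h1
    linarith
  rw [key μ, key ν]
  have hF : Continuous fun x => Real.toNNReal (f x - f ⊥) := by fun_prop
  have hi : Integrable (fun x => f x - f ⊥) ν :=
    integrable_of_continuous (hf.sub continuous_const)
  have hle := ENNReal.toReal_mono hi.lintegral_lt_top.ne
    (h _ hF fun x y hxy => Real.toNNReal_le_toNNReal (sub_le_sub_right (hm hxy) _))
  exact add_le_add hle le_rfl

/-- Layer-cake formula; it reduces the comparison of increasing functions to that of increasing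
events. -/
lemma lintegral_le_of_measure_lt_le {X Y : Type*} [MeasurableSpace X] [MeasurableSpace Y]
    {μ : Measure X} {ν : Measure Y} {F : X → NNReal} {G : Y → NNReal} (hF : Measurable F)
    (hG : Measurable G) (h : ∀ t : ℝ, 0 < t → μ {x | t < F x} ≤ ν {y | t < G y}) :
    ∫⁻ x, F x ∂μ ≤ ∫⁻ y, G y ∂ν := by
  have h1 := lintegral_eq_lintegral_meas_lt μ (f := fun x => (F x : ℝ))
    (Filter.Eventually.of_forall fun x => NNReal.coe_nonneg _) (by fun_prop)
  have h2 := lintegral_eq_lintegral_meas_lt ν (f := fun x => (G x : ℝ))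
    (Filter.Eventually.of_forall fun x => NNReal.coe_nonneg _) (by fun_prop)
  simp only [ENNReal.ofReal_coe_nnreal] at h1 h2
  rw [h1, h2]
  exact setLIntegral_mono' measurableSet_Ioi fun t ht => h t ht

/-! ### Replacing one measure by another block by block -/

lemma splice_union {A B : Set S} (x y y' : Config S) :
    splice B (splice A x y) y' = splice (A ∪ B) x (splice B y y') := by
  funext s
  by_cases hB : s ∈ B
  · rw [splice_of_mem hB, splice_of_mem (Set.mem_union_right A hB), splice_of_mem hB]
  · rw [splice_of_notMem hB]
    by_cases hA : s ∈ A
    · rw [splice_of_mem hA, splice_of_mem (Set.mem_union_left B hA), splice_of_notMem hB]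
    · rw [splice_of_notMem hA, splice_of_notMem (by simp [hA, hB])]

lemma splice_comm {A B : Set S} (h : Disjoint A B) (x y z : Config S) :
    splice A (splice B x z) y = splice B (splice A x y) z := by
  funext s
  by_cases hB : s ∈ B
  · have hA : s ∉ A := fun hA => Set.disjoint_left.1 h hA hB
    rw [splice_of_notMem hA, splice_of_mem hB, splice_of_mem hB]
  · by_cases hA : s ∈ A
    · rw [splice_of_mem hA, splice_of_notMem hB, splice_of_mem hA]
    · rw [splice_of_notMem hA, splice_of_notMem hB, splice_of_notMem hB, splice_of_notMem hA]

/-- Domination block by block implies domination, when both measures make the blocks (the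
fibres of `b`) independent. -/
theorem LDom.of_blocks [Countable S] [Countable J] {μ ν : Measure (Config S)}
    [IsProbabilityMeasure μ] [IsProbabilityMeasure ν] (b : S → J)
    (hμ : ∀ j, ResampleInvariant (b ⁻¹' {j}) μ) (hν : ∀ j, ResampleInvariant (b ⁻¹' {j}) ν)
    (h : ∀ j, ∀ r : Config S, ∀ F : Config S → NNReal, Continuous F → Monotone F →
      ∫⁻ x, F (splice (b ⁻¹' {j}) r x) ∂μ ≤ ∫⁻ y, F (splice (b ⁻¹' {j}) r y) ∂ν) :
    LDom μ ν := by
  classical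
  intro F hF hm
  have hFm : Measurable fun x => (F x : ENNReal) := hF.measurable.coe_nnreal_ennreal
  let E : Set S → ENNReal := fun A => ∫⁻ x, ∫⁻ y, F (splice A x y) ∂ν ∂μ
  -- Exchange one more block: `hμ` resamples block `j` from `μ` at no cost, `h` replaces that fresh
  -- block by one from `ν`, and `hν` absorbs it into the copy of `ν` already in use.
  have step : ∀ (T : Finset J) (j : J), j ∉ T →
      E (b ⁻¹' (T : Set J)) ≤ E (b ⁻¹' (T : Set J) ∪ b ⁻¹' {j}) := by
    intro T j hj
    have hd : Disjoint (b ⁻¹' (T : Set J)) (b ⁻¹' {j}) :=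
      Disjoint.preimage b (Set.disjoint_singleton_right.2 (by simpa using hj))
    set A := b ⁻¹' (T : Set J)
    set B := b ⁻¹' {j}
    calc E A = ∫⁻ x, ∫⁻ x', ∫⁻ y, F (splice A (splice B x x') y) ∂ν ∂μ ∂μ :=
          (hμ j (fun x => ∫⁻ y, F (splice A x y) ∂ν)
            (Measurable.lintegral_prod_right' (f := fun p : Config S × Config S =>
              (F (splice A p.1 p.2) : ENNReal)) (hFm.comp (measurable_splice A)))).symm
      _ = ∫⁻ x, ∫⁻ y, ∫⁻ x', F (splice B (splice A x y) x') ∂μ ∂ν ∂μ := by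
          refine lintegral_congr fun x => ?_
          simp_rw [splice_comm hd]
          refine lintegral_lintegral_swap (Measurable.aemeasurable ?_)
          refine hFm.comp (g := fun x => (F x : ENNReal)) (f := fun p : Config S × Config S =>
            splice B (splice A x p.2) p.1) ?_
          fun_prop
      _ ≤ ∫⁻ x, ∫⁻ y, ∫⁻ y', F (splice B (splice A x y) y') ∂ν ∂ν ∂μ :=
          lintegral_mono fun x => lintegral_mono fun y => h j _ F hF hm
      _ = ∫⁻ x, ∫⁻ y, ∫⁻ y', F (splice (A ∪ B) x (splice B y y')) ∂ν ∂ν ∂μ := by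
          simp_rw [splice_union]
      _ = E (A ∪ B) := lintegral_congr fun x =>
          hν j (fun y => F (splice (A ∪ B) x y)) (hFm.comp (by fun_prop))
  have le : ∀ T : Finset J, E ∅ ≤ E (b ⁻¹' (T : Set J)) := by
    intro T
    induction T using Finset.induction_on with
    | empty => simp
    | insert j T hj ih =>
      refine ih.trans ((step T j hj).trans_eq ?_)
      congr 1
      ext; simp [or_comm]
  have h0 : E ∅ = ∫⁻ x, F x ∂μ := by
    have : ∀ x y : Config S, splice ∅ x y = x :=
      fun x y => funext fun s => splice_of_notMem (by simp) x y
    simp [E, this]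
  have hE : ∀ A, E A = ∫⁻ p, F (splice A p.1 p.2) ∂(μ.prod ν) := fun A =>
    (lintegral_prod _ (hFm.comp (measurable_splice A)).aemeasurable).symm
  -- Each coordinate `s` comes from `ν` as soon as `b s ∈ T`, so continuity of `F` gives pointwise
  -- convergence; the constant `F ⊤` dominates.
  have hlim : Filter.Tendsto (fun T : Finset J => E (b ⁻¹' (T : Set J))) Filter.atTop
      (nhds (∫⁻ p, F p.2 ∂(μ.prod ν))) := by
    simp_rw [hE]
    refine tendsto_lintegral_filter_of_dominated_convergence (fun _ => (F ⊤ : ENNReal))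
      (Filter.Eventually.of_forall fun T => (hFm.comp (measurable_splice _)))
      (Filter.Eventually.of_forall fun T => Filter.Eventually.of_forall fun p => ?_)
      (by simp) (Filter.Eventually.of_forall fun p => ?_)
    · exact ENNReal.coe_le_coe.2 (hm le_top)
    · refine (ENNReal.continuous_coe.tendsto _).comp ((hF.tendsto _).comp
        (tendsto_pi_nhds.2 fun s => tendsto_const_nhds.congr' ?_))
      filter_upwards [Filter.eventually_ge_atTop {b s}] with T hT
      exact (splice_of_mem (by simpa using hT) _ _).symm
  rw [← h0]
  refine (ge_of_tendsto' hlim le).trans_eq ?_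
  rw [lintegral_prod (fun p : Config S × Config S => (F p.2 : ENNReal))
    (hFm.comp measurable_snd).aemeasurable]
  simp

/-! ### Block measures and their thinnings -/

/-- Each fibre of `b` is, independently and with probability `δ`, set to `0`;
all other coordinates are `1`. -/
def blockMeasure (b : S → J) (δ : unitInterval) : Measure (Config S) :=
  (prodMeasure J δ).map fun ω s => !ω (b s)

lemma measurable_blockMap (b : S → J) : Measurable fun (ω : Config J) s => !ω (b s) := by
  fun_prop

instance (b : S → J) (δ : unitInterval) : IsProbabilityMeasure (blockMeasure b δ) :=
  Measure.isProbabilityMeasure_map (measurable_blockMap b).aemeasurable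

lemma measurable_thinningMap :
    Measurable fun (x : Config S × Config S) s => x.1 s && !(x.2 s) := by fun_prop

instance (μ : Measure (Config S)) [IsProbabilityMeasure μ] (ε : unitInterval) :
    IsProbabilityMeasure (thinning μ ε) :=
  Measure.isProbabilityMeasure_map measurable_thinningMap.aemeasurable

/-- Thinning keeps each `1` with probability `1 - ε`. -/
lemma lintegral_thinning (μ : Measure (Config S)) [SFinite μ] (ε : unitInterval)
    {F : Config S → ENNReal} (hF : Measurable F) :
    ∫⁻ x, F x ∂(thinning μ ε) =
      ∫⁻ x, ∫⁻ z, F (fun s => x s && z s) ∂(prodMeasure S (unitInterval.symm ε)) ∂μ := by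
  rw [thinning, lintegral_map hF measurable_thinningMap,
    lintegral_prod (fun x : Config S × Config S => F fun s => x.1 s && !(x.2 s))
      (hF.comp measurable_thinningMap).aemeasurable]
  refine lintegral_congr fun x => ?_
  rw [← prodMeasure_map_not, lintegral_map (f := fun z : Config S => F fun s => x s && z s)
    (hF.comp (by fun_prop)) (by fun_prop)]

lemma lintegral_thinning_blockMeasure (b : S → J) (δ ε : unitInterval)
    {F : Config S → ENNReal} (hF : Measurable F) :
    ∫⁻ x, F x ∂(thinning (blockMeasure b δ) ε) =
      ∫⁻ ω, ∫⁻ z, F (fun s => !ω (b s) && z s) ∂(prodMeasure S (unitInterval.symm ε))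
        ∂(prodMeasure J δ) := by
  rw [lintegral_thinning _ _ hF, blockMeasure, lintegral_map _ (measurable_blockMap b)]
  exact Measurable.lintegral_prod_right' (f := fun p : Config S × Config S =>
    F (fun s => p.1 s && p.2 s)) (hF.comp (by fun_prop))

lemma splice_thinned_block (b : S → J) (A : Set J) (ω ω' : Config J) (z z' : Config S) :
    splice (b ⁻¹' A) (fun s => !ω (b s) && z s) (fun s => !ω' (b s) && z' s) =
      fun s => !splice A ω ω' (b s) && splice (b ⁻¹' A) z z' s := by
  funext s
  by_cases h : b s ∈ A
  · simp only [splice_of_mem (A := b ⁻¹' A) (s := s) h, splice_of_mem h]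
  · simp only [splice_of_notMem (A := b ⁻¹' A) (s := s) h, splice_of_notMem h]

/-- The thinned measure is an image of independent block marks and site marks. Splicing two images
along `b ⁻¹' A` splices the block marks along `A` and the site marks along `b ⁻¹' A`, and both
product measures are resample invariant. -/
lemma resampleInvariant_thinning_blockMeasure (b : S → J) (A : Set J) (δ ε : unitInterval) :
    ResampleInvariant (b ⁻¹' A) (thinning (blockMeasure b δ) ε) := by
  intro F hF
  set q := unitInterval.symm ε
  have h1 : ∀ x, ∫⁻ y, F (splice (b ⁻¹' A) x y) ∂(thinning (blockMeasure b δ) ε) =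
      ∫⁻ ω', ∫⁻ z', F (splice (b ⁻¹' A) x (fun s => !ω' (b s) && z' s)) ∂(prodMeasure S q)
        ∂(prodMeasure J δ) := fun x =>
    lintegral_thinning_blockMeasure b δ ε (F := fun y => F (splice (b ⁻¹' A) x y))
      (hF.comp (by fun_prop))
  have hm : Measurable fun x => ∫⁻ y, F (splice (b ⁻¹' A) x y) ∂(thinning (blockMeasure b δ) ε) :=
    Measurable.lintegral_prod_right' (f := fun p : Config S × Config S =>
      F (splice (b ⁻¹' A) p.1 p.2)) (hF.comp (by fun_prop))
  have hG : Measurable fun p : Config J × Config S => F (fun s => !p.1 (b s) && p.2 s) :=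
    hF.comp (by fun_prop)
  rw [lintegral_thinning_blockMeasure b δ ε hm, lintegral_thinning_blockMeasure b δ ε hF,
    ← resampleInvariant_prodMeasure A δ _ hG.lintegral_prod_right']
  refine lintegral_congr fun ω => ?_
  simp_rw [h1, splice_thinned_block]
  rw [lintegral_lintegral_swap]
  · refine lintegral_congr fun ω' => ?_
    exact resampleInvariant_prodMeasure (b ⁻¹' A) q
      (fun z => F (fun s => !splice A ω ω' (b s) && z s)) (hF.comp (by fun_prop))
  · refine (Measurable.lintegral_prod_right' (f := fun p : (Config S × Config J) × Config S =>
      F (fun s => !splice A ω p.1.2 (b s) && splice (b ⁻¹' A) p.1.1 p.2 s))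
      (hF.comp ?_)).aemeasurable
    fun_prop

/-! ### Comparison on a single block -/

/-- If `b ≤ 1 - d`, then `b² ≤ (1-d) b`; otherwise `(1-d) b ≥ (1-d)² ≥ 1 - 2d`. The slack `d²` is
why the killing probability is half that of an all-zero block. -/
lemma le_one_sub_mul_of_le_sq {a b d : ℝ} (hb : 0 ≤ b) (hd : d ≤ 1) (h1 : a ≤ b ^ 2)
    (h2 : a ≤ 1 - 2 * d) : a ≤ (1 - d) * b := by
  by_cases h : b ≤ 1 - d
  · nlinarith
  · push Not at h
    nlinarith [sq_nonneg d]

/-- An increasing event that fails when all coordinates in `T` are `0` is less likely under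
`π_{1/2}` than under `π_q`, `q² = 1/2`, by a factor `1 - 2^{-(|T|+1)}`. -/
lemma prodMeasure_half_le {A : Set (Config S)} (hA : MeasurableSet A) (hu : IsUpperSet A)
    {T : Finset S} (hT : Disjoint (allOff T) A) {q δ : unitInterval} (hq : (q * q : ℝ) = 1 / 2)
    (hδ : (2 * δ : ℝ) ≤ (1 / 2) ^ T.card) :
    prodMeasure S (q * q) A ≤
      unitInterval.toNNReal (unitInterval.symm δ) * prodMeasure S q A := by
  have h1 : (prodMeasure S (q * q)).real A ≤ (prodMeasure S q).real A ^ 2 := by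
    rw [measureReal_def, measureReal_def, ← ENNReal.toReal_pow]
    exact ENNReal.toReal_mono (by finiteness) (prodMeasure_mul_self_le hA hu q)
  have h2 : (prodMeasure S (q * q)).real A ≤ 1 - 2 * δ := by
    have h3 : (prodMeasure S (q * q)).real (allOff T) = (1 / 2) ^ T.card := by
      rw [measureReal_def, prodMeasure_allOff, ENNReal.toReal_pow]
      congr 1
      simp only [ENNReal.coe_toReal, unitInterval.coe_toNNReal, unitInterval.coe_symm_eq,
        Set.Icc.coe_mul, hq]
      norm_num
    have h4 := measureReal_union (μ := prodMeasure S (q * q)) hT hA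
    have h5 := measureReal_le_one (μ := prodMeasure S (q * q)) (s := allOff T ∪ A)
    linarith
  have h := le_one_sub_mul_of_le_sq measureReal_nonneg δ.2.2 h1 h2
  rw [← ENNReal.toReal_le_toReal (by finiteness) (by finiteness), ENNReal.toReal_mul]
  simpa [measureReal_def] using h

lemma splice_eq_of_mem_allOff {B : Set S} {T : Finset S} (hT : (T : Set S) = B)
    {x : Config S} (hx : x ∈ allOff T) (r : Config S) : splice B r x = splice B r ⊥ := by
  funext s
  by_cases h : s ∈ B
  · rw [splice_of_mem h, splice_of_mem h, hx s (by rwa [← Finset.mem_coe, hT])]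
    rfl
  · rw [splice_of_notMem h, splice_of_notMem h]

/-- The comparison on a single block. -/
lemma lintegral_splice_le_thinning_blockMeasure [Countable S] (b : S → J) (j : J) {T : Finset S}
    (hT : (T : Set S) = b ⁻¹' {j}) {q δ : unitInterval} (hq : (q * q : ℝ) = 1 / 2)
    (hδ : (2 * δ : ℝ) ≤ (1 / 2) ^ T.card) (r : Config S) {F : Config S → NNReal}
    (hF : Continuous F) (hm : Monotone F) :
    ∫⁻ x, F (splice (b ⁻¹' {j}) r x) ∂(prodMeasure S (q * q)) ≤
      ∫⁻ y, F (splice (b ⁻¹' {j}) r y)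
        ∂(thinning (blockMeasure b δ) (unitInterval.symm q)) := by
  set B := b ⁻¹' {j}
  have hG : Measurable fun x => F (splice B r x) := hF.measurable.comp (by fun_prop)
  have hH : Measurable fun p : Config J × Config S =>
      F (splice B r fun s => !p.1 (b s) && p.2 s) := hF.measurable.comp (by fun_prop)
  rw [lintegral_thinning_blockMeasure b δ _ hG.coe_nnreal_ennreal, unitInterval.symm_symm,
    ← lintegral_prod (fun p : Config J × Config S =>
      (F (splice B r fun s => !p.1 (b s) && p.2 s) : ENNReal)) hH.coe_nnreal_ennreal.aemeasurable]
  refine lintegral_le_of_measure_lt_le hG hH fun t _ => ?_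
  -- A superlevel set containing the zero block is everything, on both sides. Any other one misses
  -- `allOff T`, as `prodMeasure_half_le` requires.
  by_cases h0 : t < F (splice B r ⊥)
  · have : {p : Config J × Config S | t < F (splice B r fun s => !p.1 (b s) && p.2 s)} =
        Set.univ := Set.eq_univ_of_forall fun p => h0.trans_le
          (NNReal.coe_le_coe.2 (hm (monotone_splice_right B r bot_le)))
    rw [this, measure_univ]
    exact prob_le_one
  · have hA : MeasurableSet {x | t < F (splice B r x)} :=
      measurableSet_lt measurable_const (by fun_prop)
    have hu : IsUpperSet {x | t < F (splice B r x)} := fun x y hxy hx =>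
      lt_of_lt_of_le hx (NNReal.coe_le_coe.2 (hm (monotone_splice_right B r hxy)))
    have hd : Disjoint (allOff T) {x | t < F (splice B r x)} := by
      refine Set.disjoint_left.2 fun x hx hx' => h0 ?_
      rw [← splice_eq_of_mem_allOff hT hx]
      exact hx'
    refine (prodMeasure_half_le hA hu hd hq hδ).trans ?_
    have h1 := prodMeasure_allOff (S := J) δ {j}
    rw [Finset.card_singleton, pow_one] at h1
    rw [← h1, ← Measure.prod_prod]
    -- It suffices to keep the event that block `j` is not killed; on it the thinned block coincides
    -- with the site marks `p.2`.
    refine measure_mono fun p hp => ?_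
    have : splice B r (fun s => !p.1 (b s) && p.2 s) = splice B r p.2 := by
      funext s
      by_cases h : s ∈ B
      · have hj : p.1 j = false := hp.1 j (by simp)
        have hs : b s = j := h
        rw [splice_of_mem h, splice_of_mem h, hs, hj]
        simp
      · rw [splice_of_notMem h, splice_of_notMem h]
    change t < F (splice B r (fun s => !p.1 (b s) && p.2 s))
    rw [this]
    exact hp.2

theorem lDom_thinning_blockMeasure [Countable S] [Countable J] (b : S → J) {T : J → Finset S}
    (hT : ∀ j, (T j : Set S) = b ⁻¹' {j}) {q δ : unitInterval} (hq : (q * q : ℝ) = 1 / 2)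
    (hδ : ∀ j, (2 * δ : ℝ) ≤ (1 / 2) ^ (T j).card) :
    LDom (prodMeasure S (q * q)) (thinning (blockMeasure b δ) (unitInterval.symm q)) :=
  LDom.of_blocks b (fun _ => resampleInvariant_prodMeasure _ _)
    (fun _ => resampleInvariant_thinning_blockMeasure b _ _ _)
    fun j r _ hF hm => lintegral_splice_le_thinning_blockMeasure b j (hT j) hq (hδ j) r hF hm

/-! ### Averaging over shifts and mixing over block lengths -/

/-- The probability `2^{-(N+1)}`, half the `π_{1/2}`-probability that `N` given coordinates
all are `0`. -/
def blockKillProb (N : ℕ) : unitInterval :=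
  ⟨(1 / 2) ^ (N + 1), by positivity, pow_le_one₀ (by norm_num) (by norm_num)⟩

lemma coe_blockKillProb (N : ℕ) : (blockKillProb N : ℝ) = (1 / 2) ^ (N + 1) := rfl

/-- The partition of `S ≃ ℤ` into blocks of `N` consecutive elements, shifted by `i`. -/
def shiftedBlock (e : S ≃ ℤ) (N : ℕ) (i : ℤ) (s : S) : ℤ := (e s + i) / N

/-- The block measure for blocks of length `N`, averaged over the shifts. -/
def averagedBlockMeasure (e : S ≃ ℤ) (N : ℕ) : Measure (Config S) :=
  (N : ENNReal)⁻¹ • ∑ i ∈ Finset.range N, blockMeasure (shiftedBlock e N i) (blockKillProb N)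

/-- The mixture of the averaged block measures for the block lengths `2^k`. -/
def mixedBlockMeasure (e : S ≃ ℤ) : Measure (Config S) :=
  Measure.sum fun k : ℕ => ((2 : ENNReal)⁻¹ ^ (k + 1)) • averagedBlockMeasure e (2 ^ k)

/-- The block with index `j`. -/
def blockFinset (e : S ≃ ℤ) (N : ℕ) (i j : ℤ) : Finset S :=
  (Finset.Ico (j * N - i) (j * N + N - i)).map e.symm.toEmbedding

lemma card_blockFinset (e : S ≃ ℤ) (N : ℕ) (i j : ℤ) : (blockFinset e N i j).card = N := by
  simp [blockFinset]

lemma coe_blockFinset (e : S ≃ ℤ) {N : ℕ} (hN : 0 < N) (i j : ℤ) :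
    (blockFinset e N i j : Set S) = shiftedBlock e N i ⁻¹' {j} := by
  have hN' : (0 : ℤ) < N := by exact_mod_cast hN
  ext s
  have h1 : s ∈ blockFinset e N i j ↔ j * N - i ≤ e s ∧ e s < j * N + N - i := by
    simp [blockFinset, Finset.mem_map_equiv]
  have h2 : (e s + i) / N = j ↔ j * N ≤ e s + i ∧ e s + i < (j + 1) * N := by
    rw [← Int.le_ediv_iff_mul_le hN', ← Int.ediv_lt_iff_lt_mul hN']
    omega
  rw [Finset.mem_coe, h1]
  change _ ↔ (e s + i) / N = j
  rw [h2, add_mul]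
  constructor <;> rintro ⟨_, _⟩ <;> constructor <;> linarith

instance (e : S ≃ ℤ) (N : ℕ) [NeZero N] : IsProbabilityMeasure (averagedBlockMeasure e N) where
  measure_univ := by
    simp only [averagedBlockMeasure, Measure.smul_apply, Measure.finsetSum_apply, measure_univ,
      Finset.sum_const, Finset.card_range, smul_eq_mul, nsmul_eq_mul, mul_one]
    exact ENNReal.inv_mul_cancel (by simpa using NeZero.ne N) (by simp)

lemma tsum_two_inv_pow_succ : ∑' k : ℕ, (2 : ENNReal)⁻¹ ^ (k + 1) = 1 := by
  simp_rw [pow_succ]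
  rw [ENNReal.tsum_mul_right, ENNReal.tsum_geometric, ENNReal.one_sub_inv_two, inv_inv]
  exact ENNReal.mul_inv_cancel (by simp) (by simp)

instance (e : S ≃ ℤ) : IsProbabilityMeasure (mixedBlockMeasure e) where
  measure_univ := by
    simp [mixedBlockMeasure, Measure.sum_apply, tsum_two_inv_pow_succ]

/-- By `lintegral_thinning`, thinning is linear in the measure, so a lower bound valid for every
shift passes to the average. -/
lemma lDom_thinning_averagedBlockMeasure [Countable S] (e : S ≃ ℤ) (N : ℕ) [NeZero N]
    {q : unitInterval} (hq : (q * q : ℝ) = 1 / 2) :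
    LDom (prodMeasure S (q * q))
      (thinning (averagedBlockMeasure e N) (unitInterval.symm q)) := by
  intro F hF hm
  have hFm : Measurable fun x => (F x : ENNReal) := hF.measurable.coe_nnreal_ennreal
  have h : ∀ i ∈ Finset.range N, ∫⁻ x, F x ∂(prodMeasure S (q * q)) ≤
      ∫⁻ x, F x ∂(thinning (blockMeasure (shiftedBlock e N i) (blockKillProb N))
        (unitInterval.symm q)) := fun i _ =>
    lDom_thinning_blockMeasure _ (T := blockFinset e N i)
      (coe_blockFinset e (Nat.pos_of_neZero N) i) hq (fun j => by
        rw [card_blockFinset, coe_blockKillProb, pow_succ]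
        linarith) F hF hm
  have h' := Finset.card_nsmul_le_sum _ _ _ h
  simp_rw [lintegral_thinning _ _ hFm] at h' ⊢
  rw [averagedBlockMeasure, lintegral_smul_measure, lintegral_finsetSum_measure]
  rw [Finset.card_range, nsmul_eq_mul] at h'
  refine le_trans (le_of_eq ?_) (mul_le_mul_right h' (N : ENNReal)⁻¹)
  rw [← mul_assoc, ENNReal.inv_mul_cancel (by simpa using NeZero.ne N) (by simp), one_mul]

lemma lDom_thinning_mixedBlockMeasure [Countable S] (e : S ≃ ℤ) {q : unitInterval}
    (hq : (q * q : ℝ) = 1 / 2) :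
    LDom (prodMeasure S (q * q)) (thinning (mixedBlockMeasure e) (unitInterval.symm q)) := by
  intro F hF hm
  have hFm : Measurable fun x => (F x : ENNReal) := hF.measurable.coe_nnreal_ennreal
  have h := fun k : ℕ => lDom_thinning_averagedBlockMeasure e (2 ^ k) hq F hF hm
  simp_rw [lintegral_thinning _ _ hFm] at h ⊢
  rw [mixedBlockMeasure, lintegral_sum_measure]
  simp_rw [lintegral_smul_measure]
  refine le_trans (le_of_eq ?_) (ENNReal.tsum_le_tsum fun k => mul_le_mul_right (h k) _)
  rw [ENNReal.tsum_mul_right, tsum_two_inv_pow_succ, one_mul]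

/-- Domination passes from a thinned measure to the measure itself. -/
lemma LDom.of_thinning {μ ν : Measure (Config S)} [SFinite ν] [Countable S] {ε : unitInterval}
    (h : LDom μ (thinning ν ε)) : LDom μ ν := by
  intro F hF hm
  refine (h F hF hm).trans ?_
  rw [lintegral_thinning _ _ hF.measurable.coe_nnreal_ennreal]
  refine lintegral_mono fun x => ?_
  refine (lintegral_mono (g := fun _ => (F x : ENNReal)) fun z =>
    ENNReal.coe_le_coe.2 (hm fun s => Bool.and_le_left _ _)).trans ?_
  simp

/-! ### Upper bound on the dominated densities -/

lemma StochDom.measureReal_allOff_le {μ ν : Measure (Config S)} [IsProbabilityMeasure μ]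
    [IsProbabilityMeasure ν] (h : StochDom μ ν) (T : Finset S) :
    ν.real (allOff T) ≤ μ.real (allOff T) := by
  classical
  -- Clopenness makes the indicator of the complement continuous, hence an admissible increasing
  -- test function.
  have hc : IsClopen (allOff T) := by
    have : allOff T = ⋂ s ∈ T, (fun σ : Config S => σ s) ⁻¹' {false} := by
      ext; simp [allOff]
    rw [this]
    exact isClopen_biInter_finset fun s _ => (isClopen_discrete _).preimage (continuous_apply s)
  have hm : Monotone ((allOff T)ᶜ.indicator (fun _ => (1 : ℝ))) := by
    intro x y hxy
    by_cases hy : y ∈ allOff T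
    · have hx : x ∈ allOff T := fun s hs => by
        have := hxy s
        rw [hy s hs] at this
        exact le_bot_iff.1 this
      simp [hx, hy]
    · rw [Set.indicator_of_mem (Set.mem_compl hy)]
      exact Set.indicator_le_self' (fun _ _ => zero_le_one) x
  have := h _ (hc.compl.continuous_indicator continuous_const) hm
  rw [integral_indicator_const _ (measurableSet_allOff T).compl,
    integral_indicator_const _ (measurableSet_allOff T).compl,
    probReal_compl_eq_one_sub (measurableSet_allOff T),
    probReal_compl_eq_one_sub (measurableSet_allOff T)] at this
  simp only [smul_eq_mul, mul_one] at this
  linarith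

lemma le_blockMeasure_allOff {J : Type*} (b : S → J) (δ : unitInterval) (j : J) {T : Finset S}
    (hT : (T : Set S) = b ⁻¹' {j}) :
    (unitInterval.toNNReal δ : ENNReal) ≤ blockMeasure b δ (allOff T) := by
  have h := prodMeasure_allOn δ {j}
  rw [Finset.card_singleton, pow_one] at h
  rw [← h, blockMeasure, Measure.map_apply (measurable_blockMap b) (measurableSet_allOff T)]
  refine measure_mono fun ω hω s hs => ?_
  have hs : b s = j := by
    have : s ∈ b ⁻¹' {j} := hT ▸ hs
    exact this
  have hj : ω j = true := hω j (by simp)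
  simp [hs, hj]

/-- Only the component of length `2^k` with shift `0` is kept; there the finite set is exactly one
block. -/
lemma le_mixedBlockMeasure_allOff (e : S ≃ ℤ) (k : ℕ) :
    (2 : ENNReal)⁻¹ ^ (k + 1) * (((2 ^ k : ℕ) : ENNReal)⁻¹ *
      unitInterval.toNNReal (blockKillProb (2 ^ k))) ≤
      mixedBlockMeasure e (allOff (blockFinset e (2 ^ k) 0 0)) := by
  have hm := measurableSet_allOff (blockFinset e (2 ^ k) 0 0)
  rw [mixedBlockMeasure, Measure.sum_apply _ hm]
  refine le_trans ?_ (ENNReal.le_tsum k)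
  rw [Measure.smul_apply, smul_eq_mul, averagedBlockMeasure, Measure.smul_apply, smul_eq_mul,
    Measure.finsetSum_apply]
  gcongr
  refine (le_blockMeasure_allOff (shiftedBlock e (2 ^ k) 0) _ 0
    (coe_blockFinset e (by positivity) 0 0)).trans ?_
  exact Finset.single_le_sum (f := fun i : ℕ => blockMeasure (shiftedBlock e (2 ^ k) i)
    (blockKillProb (2 ^ k)) (allOff (blockFinset e (2 ^ k) 0 0))) (fun _ _ => zero_le)
    (Finset.mem_range.2 (by positivity : 0 < 2 ^ k))

/-- Polynomial factors do not matter on the exponential scale. -/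
lemma half_le_of_forall_two_pow {r : ℝ} (hr : 0 ≤ r)
    (h : ∀ k : ℕ, (1 / 2) ^ (k + 1) * (((2 ^ k : ℕ) : ℝ)⁻¹ * (1 / 2) ^ (2 ^ k + 1)) ≤
      r ^ (2 ^ k)) : 1 / 2 ≤ r := by
  by_contra! hlt
  -- If `r < 1/2`, then `N² (2r)^N → 0` along `N = 2^k`, while `h` multiplied by `N² 2^N` says that
  -- this quantity is at least `1/4`.
  have ht := (tendsto_pow_const_mul_const_pow_of_abs_lt_one 2 (r := 2 * r)
    (by rw [abs_of_nonneg (by positivity)]; linarith)).comp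
    (tendsto_pow_atTop_atTop_of_one_lt (one_lt_two (α := ℕ)))
  obtain ⟨k, hk⟩ := (ht.eventually (gt_mem_nhds (show (0 : ℝ) < 1 / 4 by norm_num))).exists
  have h1 := h k
  simp only [Function.comp_apply] at hk
  have hN : (0 : ℝ) < ((2 ^ k : ℕ) : ℝ) := by positivity
  -- Lengths `2^k` make the geometric weight only polynomially small in `N`: it equals `1/(2N)`.
  have h2 : (1 / 2 : ℝ) ^ (k + 1) = 1 / 2 * ((2 ^ k : ℕ) : ℝ)⁻¹ := by
    rw [pow_succ]; push_cast; simp [mul_comm]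
  rw [h2] at h1
  generalize 2 ^ k = N at *
  have h3 := mul_le_mul_of_nonneg_left h1 (by positivity : (0 : ℝ) ≤ (N : ℝ) ^ 2 * 2 ^ N)
  have h4 : (N : ℝ) ^ 2 * 2 ^ N * (1 / 2 * (N : ℝ)⁻¹ * ((N : ℝ)⁻¹ * (1 / 2) ^ (N + 1))) =
      1 / 4 := by
    rw [pow_succ, one_div_pow]
    field_simp
    ring
  rw [mul_pow] at hk
  nlinarith

lemma le_half_of_stochDom_mixedBlockMeasure (e : S ≃ ℤ) {p : unitInterval}
    (h : StochDom (prodMeasure S p) (mixedBlockMeasure e)) : (p : ℝ) ≤ 1 / 2 := by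
  have key : (1 / 2 : ℝ) ≤ 1 - p := by
    refine half_le_of_forall_two_pow (sub_nonneg.2 p.2.2) fun k => ?_
    have h1 := h.measureReal_allOff_le (blockFinset e (2 ^ k) 0 0)
    have h2 := ENNReal.toReal_mono (by finiteness) (le_mixedBlockMeasure_allOff e k)
    have h3 := h2.trans h1
    rw [measureReal_def, prodMeasure_allOff, card_blockFinset] at h3
    simpa [coe_blockKillProb] using h3
  linarith

/-- The mixture of block measures is nonrigid, and its maximal dominated density is `1/2`. -/
theorem mixedBlockMeasure_nonrigid [Countable S] (e : S ≃ ℤ) :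
    (∃ p : unitInterval, 0 < p ∧ p < 1 ∧ StochDom (prodMeasure S p) (mixedBlockMeasure e)) ∧
      (pMax (mixedBlockMeasure e) : ℝ) = 1 / 2 ∧ Nonrigid (mixedBlockMeasure e) := by
  have hs : √(1 / 2 : ℝ) * √(1 / 2) = 1 / 2 := Real.mul_self_sqrt (by norm_num)
  have hs0 : 0 < √(1 / 2 : ℝ) := Real.sqrt_pos.2 (by norm_num)
  have hs1 : √(1 / 2 : ℝ) < 1 := by nlinarith
  let q : unitInterval := ⟨√(1 / 2), hs0.le, hs1.le⟩
  have hq : (q * q : ℝ) = 1 / 2 := hs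
  have hd := lDom_thinning_mixedBlockMeasure e hq
  have hd' := hd.of_thinning.stochDom
  have hmax : pMax (mixedBlockMeasure e) = q * q := by
    refine IsGreatest.csSup_eq ⟨hd', fun p hp => ?_⟩
    rw [← Subtype.coe_le_coe, Set.Icc.coe_mul, hq]
    exact le_half_of_stochDom_mixedBlockMeasure e hp
  refine ⟨⟨q * q, ?_, ?_, hd'⟩, ?_, ?_⟩
  · rw [← Subtype.coe_lt_coe, Set.Icc.coe_mul, hq]; norm_num
  · rw [← Subtype.coe_lt_coe, Set.Icc.coe_mul, hq]; norm_num
  · rw [hmax, Set.Icc.coe_mul, hq]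
  · rw [Nonrigid, hmax]
    refine ⟨hd', unitInterval.symm q, ?_, ?_, hd.stochDom⟩
    · rw [← Subtype.coe_lt_coe]
      exact sub_pos.2 hs1
    · rw [← Subtype.coe_lt_coe]
      exact sub_lt_self 1 hs0

/-! ### Translation invariance on the integers -/

lemma measurable_shift (n : ℤ) : Measurable fun (σ : Config ℤ) s => σ (s + n) := by fun_prop

lemma map_shift_blockMeasure (N : ℕ) (i n : ℤ) (δ : unitInterval) :
    (blockMeasure (shiftedBlock (Equiv.refl ℤ) N i) δ).map (fun σ s => σ (s + n)) =
      blockMeasure (shiftedBlock (Equiv.refl ℤ) N (i + n)) δ := by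
  rw [blockMeasure, Measure.map_map (measurable_shift n) (measurable_blockMap _), blockMeasure]
  congr 1
  funext ω s
  simp only [Function.comp_apply, shiftedBlock, Equiv.refl_apply]
  congr 3
  ring

/-- Shifting by a full period only renames block `j` as `j + 1`, which the i.i.d. block marks do not
detect. -/
lemma blockMeasure_shiftedBlock_add_period (e : S ≃ ℤ) {N : ℕ} (hN : 0 < N) (i : ℤ)
    (δ : unitInterval) :
    blockMeasure (shiftedBlock e N (i + N)) δ = blockMeasure (shiftedBlock e N i) δ := by
  have h := prodMeasure_map_comp (add_left_injective (1 : ℤ)) δ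
  conv_rhs => rw [blockMeasure, ← h, Measure.map_map (measurable_blockMap _) (by fun_prop)]
  rw [blockMeasure]
  congr 1
  funext ω s
  have : (N : ℤ) ≠ 0 := by exact_mod_cast hN.ne'
  simp only [Function.comp_apply, shiftedBlock]
  rw [← add_assoc, Int.add_ediv_of_dvd_right (dvd_refl _), Int.ediv_self this]

lemma averagedBlockMeasure_map_shift_one (N : ℕ) :
    (averagedBlockMeasure (Equiv.refl ℤ) N).map (fun σ s => σ (s + 1)) =
      averagedBlockMeasure (Equiv.refl ℤ) N := by
  obtain _ | M := N
  · simp [averagedBlockMeasure]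
  ext A hA
  have h : ∀ i : ℕ, blockMeasure (shiftedBlock (Equiv.refl ℤ) (M + 1) i) (blockKillProb (M + 1))
      ((fun σ s => σ (s + 1)) ⁻¹' A) = blockMeasure (shiftedBlock (Equiv.refl ℤ) (M + 1)
        ((i + 1 : ℕ) : ℤ)) (blockKillProb (M + 1)) A := fun i => by
    rw [← Measure.map_apply (measurable_shift 1) hA, map_shift_blockMeasure]
    norm_cast
  rw [Measure.map_apply (measurable_shift 1) hA]
  simp only [averagedBlockMeasure, Measure.smul_apply, Measure.finsetSum_apply, h]
  -- Translation by one turns the shifts `0, …, M` into `1, …, M + 1`; periodicity identifies shift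
  -- `M + 1` with shift `0`.
  rw [Finset.sum_range_succ, Finset.sum_range_succ']
  congr 3
  rw [← blockMeasure_shiftedBlock_add_period _ M.succ_pos ((0 : ℕ) : ℤ)]
  simp

lemma translationInvariant_of_map_shift_one {μ : Measure (Config ℤ)}
    (h : μ.map (fun σ s => σ (s + 1)) = μ) : TranslationInvariant μ := by
  have hcomp : ∀ m n : ℤ, (μ.map fun σ s => σ (s + m)).map (fun σ s => σ (s + n)) =
      μ.map fun σ s => σ (s + (n + m)) := fun m n => by
    rw [Measure.map_map (measurable_shift n) (measurable_shift m)]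
    congr 1
    funext σ s
    simp only [Function.comp_apply, add_assoc]
  have h0 : (μ.map fun σ s => σ (s + 0)) = μ := by simp
  have hneg : (μ.map fun σ s => σ (s + (-1))) = μ := by
    have := hcomp 1 (-1)
    rwa [h, neg_add_cancel, h0] at this
  intro n
  induction n using Int.induction_on with
  | zero => exact h0
  | succ n ih =>
    have := hcomp n 1
    rw [ih, h, add_comm] at this
    exact this.symm
  | pred n ih =>
    have := hcomp (-n) (-1)
    rw [ih, hneg, add_comm, ← sub_eq_add_neg] at this
    exact this.symm

lemma translationInvariant_mixedBlockMeasure :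
    TranslationInvariant (mixedBlockMeasure (Equiv.refl ℤ)) := by
  refine translationInvariant_of_map_shift_one ?_
  ext A hA
  rw [Measure.map_apply (measurable_shift 1) hA, mixedBlockMeasure,
    Measure.sum_apply _ (measurable_shift 1 hA), Measure.sum_apply _ hA]
  refine tsum_congr fun k => ?_
  rw [Measure.smul_apply, Measure.smul_apply, ← Measure.map_apply (measurable_shift 1) hA,
    averagedBlockMeasure_map_shift_one]

end

theorem theorem4p2 :
    (∀ (S : Type*) [Countable S] [Infinite S],
      ∃ μ : Measure (Config S), IsProbabilityMeasure μ ∧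
        (∃ p : unitInterval, 0 < p ∧ p < 1 ∧ StochDom (prodMeasure S p) μ) ∧
        (pMax μ : ℝ) = 1 / 2 ∧ Nonrigid μ) ∧
    (∃ μ : Measure (Config ℤ), IsProbabilityMeasure μ ∧ TranslationInvariant μ ∧
        (∃ p : unitInterval, 0 < p ∧ p < 1 ∧ StochDom (prodMeasure ℤ p) μ) ∧
        (pMax μ : ℝ) = 1 / 2 ∧ Nonrigid μ) := by
  refine ⟨fun S _ _ => ?_, mixedBlockMeasure (Equiv.refl ℤ), inferInstance,
    translationInvariant_mixedBlockMeasure, mixedBlockMeasure_nonrigid _⟩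
  obtain ⟨e⟩ : Nonempty (S ≃ ℤ) := nonempty_equiv_of_countable
  exact ⟨mixedBlockMeasure e, inferInstance, mixedBlockMeasure_nonrigid e⟩
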